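/- Let $G=(V,E)$ be a finite graph, possibly with loops and multiple edges, with nonnegative real edge weights $\lambda=(\lambda_e)_{e\in E}$. For $H\subseteq E$ let $\deg(H,v)$ be the degree of the vertex $v$ in the spanning subgraph $(V,H)$, where a loop counts twice. For $f,g:V\to\mathbb{N}$ put $u^{(v)}_k=1$ if $f(v)\le k\le g(v)$ and $u^{(v)}_k=0$ otherwise, and let $$Z(G,\lambda,u;x)=\sum_{H\subseteq E}\Big(\prod_{e\in H}\lambda_e\Big)\prod_{v\in V}u^{(v)}_{\deg(H,v)}\,x_v^{\deg(H,v)}.$$ For $0<\theta\le\pi$ let $S[\theta]=\{z\in\mathbb{C}: z\ne0,\ |\arg z|<\theta\}$, with $-\pi<\arg z\le\pi$. A polynomial in complex variables is called $S[\theta]$-nonvanishing if it is identically zero or has no zero with all coordinates in $S[\theta]$. Suppose that $f(v)\le g(v)\le f(v)+1$ for every $v\in V$. Then: (1) $Z(G,\lambda,u;x)$ is $S[\pi/2]$-nonvanishing. (2) The univariate specialization $Z(G,\lambda,u;y^{1/2}\mathbf{1})$, obtained by setting $x_v=y^{1/2}$ for all $v$ (for either choice of the square root), is the polynomial $\sum_{H\subseteq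 E}\big(\prod_{e\in H}\lambda_e\big)\big(\prod_{v\in V}u^{(v)}_{\deg(H,v)}\big)y^{|H|}$ in $y$. It is $S[\pi]$-nonvanishing; that is, unless it is identically zero, all its complex zeros are real and nonpositive. (3) In the special case $f\equiv0$, $g\equiv1$, the polynomial $Z(G,\lambda,u;x)$ is the weighted multivariate matching polynomial $\sum_M\big(\prod_{e\in M}\lambda_e\big)\prod_{v\in V}x_v^{\deg(M,v)}$, where $M$ runs over the matchings of $G$ (sets of non-loop edges no two of which share an end). It is nonzero whenever $x_v\in S[\pi/2]$ for all $v\in V$ (the multivariate Heilmann–Lieb theorem). -/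

import Mathlib

noncomputable section

namespace HeilmannLieb

/-- The open sector `S[θ]` centered on the positive real axis. `Complex.arg` takes values in
`(-π, π]`. -/
def sector (θ : ℝ) : Set ℂ := {z | z ≠ 0 ∧ |Complex.arg z| < θ}

/-- A multivariate polynomial `F` is `A`-nonvanishing if it is identically zero, or has no zero
all of whose coordinates lie in `A`. -/
def IsNonvanishing {σ : Type*} (A : Set ℂ) (F : MvPolynomial σ ℂ) : Prop :=
  F = 0 ∨ ∀ z : σ → ℂ, (∀ v, z v ∈ A) → MvPolynomial.eval z F ≠ 0

/-- The same notion for polynomials in one variable. -/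
def IsNonvanishing₁ (A : Set ℂ) (F : Polynomial ℂ) : Prop :=
  F = 0 ∨ ∀ z ∈ A, F.eval z ≠ 0

variable {α β : Type*} (G : Graph α β)

open Classical in
/-- The degree of the vertex `v` in the spanning subgraph of the multigraph `G` with edge set `H`.
A loop at `v` contributes two. -/
def deg (H : Finset G.edgeSet) (v : G.vertexSet) : ℕ :=
  ∑ e ∈ H, if G.IsLoopAt e v then 2 else if G.Inc e v then 1 else 0

/-- The weight `λ^H = ∏_{e ∈ H} λ_e` of a set of edges. -/
def edgeWeight (w : G.edgeSet → ℂ) (H : Finset G.edgeSet) : ℂ := ∏ e ∈ H, w e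

/-- The monomial `x^{deg H} = ∏_v x_v^{deg(H,v)}`. -/
def degMonomial [Fintype G.vertexSet] (H : Finset G.edgeSet) : MvPolynomial G.vertexSet ℂ :=
  ∏ v : G.vertexSet, MvPolynomial.X v ^ deg G H v

/-- The weight `u_{deg H} = ∏_v u^{(v)}_{deg(H,v)}`. Only the activities `u v k` with
`k ≤ deg(G,v)` are ever used. -/
def activityWeight [Fintype G.vertexSet] (u : G.vertexSet → ℕ → ℂ) (H : Finset G.edgeSet) : ℂ :=
  ∏ v : G.vertexSet, u v (deg G H v)

/-- The polynomial `Z(G,λ,u;x) = ∑_{H ⊆ E} λ^H u_{deg H} x^{deg H}`. -/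
def Z [Fintype G.vertexSet] [Fintype G.edgeSet] (w : G.edgeSet → ℂ) (u : G.vertexSet → ℕ → ℂ) :
    MvPolynomial G.vertexSet ℂ :=
  ∑ H : Finset G.edgeSet,
    MvPolynomial.C (edgeWeight G w H * activityWeight G u H) * degMonomial G H

/-- The polynomial `∑_{H ⊆ E} λ^H u_{deg H} y^{|H|}` in one variable. -/
def univariateZ [Fintype G.vertexSet] [Fintype G.edgeSet]
    (w : G.edgeSet → ℂ) (u : G.vertexSet → ℕ → ℂ) : Polynomial ℂ :=
  ∑ H : Finset G.edgeSet,
    Polynomial.C (edgeWeight G w H * activityWeight G u H) * Polynomial.X ^ H.card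

/-- The activities `u_k^{(v)} = 1` if `f(v) ≤ k ≤ g(v)`, and `0` otherwise. -/
def degreeConstraint {ι : Type*} (f g : ι → ℕ) (v : ι) (k : ℕ) : ℂ :=
  if f v ≤ k ∧ k ≤ g v then 1 else 0

/-- A matching: a set of edges containing no loop, in which no two distinct edges share an end. -/
def IsMatching (M : Finset G.edgeSet) : Prop :=
  (∀ e ∈ M, ∀ v, ¬ G.IsLoopAt e v) ∧
    ∀ e ∈ M, ∀ e' ∈ M, e ≠ e' → ∀ v, ¬ (G.Inc e v ∧ G.Inc e' v)

open Classical in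
/-- The edge-weighted multivariate matching polynomial `∑_M λ^M x^{deg M}`, summed over all
matchings `M` of `G`. -/
def matchingPolynomial [Fintype G.vertexSet] [Fintype G.edgeSet] (w : G.edgeSet → ℂ) :
    MvPolynomial G.vertexSet ℂ :=
  ∑ M : Finset G.edgeSet with IsMatching G M,
    MvPolynomial.C (edgeWeight G w M) * degMonomial G M

end HeilmannLieb

end

/-!
If all activities are `1`, then `Z = ∏ e, (1 + λ_e x_a x_b)` over the edges `e` with ends `a`, `b`.
No factor vanishes on the right half-plane, since `1 + λ s t = s (1/s + λ t)` and the real part of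
`1/s + λ t` is positive. The activities are then imposed one vertex at a time: replacing the
activities `1` at `v` by `u v` multiplies each monomial `x^d` of `Z` by `u v (d v)`. Such an
operation preserves nonvanishing on the right half-plane as soon as `u v` is nonnegative and
supported on `{m, m + 1}` for some `m`. Indeed `∂_v` preserves nonvanishing, by the Gauss–Lucas
argument that `Re (∂_v F / F) ≥ 0`, and this reduces the claim to `m = 0`. In that case the result
is the limit as `ε → 0⁺` of `x_v F(y) ((u_0 + ε) / x_v + u_1 ∂_v F(y) / F(y))`, where `y` is `x`
with `x_v` scaled by `ε`, and the last factor has positive real part. Nonvanishing passes to limits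
of bounded degree as in Hurwitz's theorem: a polynomial of degree at most `N` without zeros in a
disc is there at most `2 ^ N` times its absolute value at the center.

For the univariate statement, `z ↦ z²` maps the right half-plane onto the slit plane `S[π]`.
-/

namespace HeilmannLieb

open Filter Finset Topology
open scoped ComplexOrder

section BoundedDegree

variable {K : Type*} [NormedField K]

lemma norm_prod_map_le {ι : Type*} {C : ℝ} {f g : ι → K} {s : Multiset ι}
    (h : ∀ i ∈ s, ‖f i‖ ≤ C * ‖g i‖) : ‖(s.map f).prod‖ ≤ C ^ s.card * ‖(s.map g).prod‖ := by
  induction s using Multiset.induction_on with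
  | empty => simp
  | cons i s ih =>
    simp only [Multiset.map_cons, Multiset.prod_cons, norm_mul, Multiset.card_cons]
    have hi := h i (Multiset.mem_cons_self i s)
    calc ‖f i‖ * ‖(s.map f).prod‖
        ≤ C * ‖g i‖ * (C ^ s.card * ‖(s.map g).prod‖) := by
          gcongr
          · exact (norm_nonneg _).trans hi
          · exact ih fun j hj => h j (Multiset.mem_cons_of_mem hj)
      _ = C ^ (s.card + 1) * (‖g i‖ * ‖(s.map g).prod‖) := by ring

lemma norm_eval_le_of_forall_ball_ne_zero {p : Polynomial K} (hp : p.Splits) {N : ℕ}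
    (hN : p.natDegree ≤ N) {c s : K} {δ : ℝ} (h : ∀ t ∈ Metric.ball c δ, p.eval t ≠ 0)
    (hs : s ∈ Metric.ball c δ) : ‖p.eval s‖ ≤ 2 ^ N * ‖p.eval c‖ := by
  have hroots : ∀ r ∈ p.roots, ‖s - r‖ ≤ 2 * ‖c - r‖ := by
    intro r hr
    have hr' : δ ≤ dist r c := by
      by_contra! hlt
      exact h r hlt (Polynomial.isRoot_of_mem_roots hr)
    rw [← dist_eq_norm, ← dist_eq_norm, dist_comm c r]
    linarith [dist_triangle_right s r c, Metric.mem_ball.1 hs]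
  rw [hp.eval_eq_prod_roots, hp.eval_eq_prod_roots, norm_mul, norm_mul, mul_left_comm]
  gcongr
  calc ‖(p.roots.map fun r => s - r).prod‖
      ≤ 2 ^ p.roots.card * ‖(p.roots.map fun r => c - r).prod‖ := norm_prod_map_le hroots
    _ ≤ 2 ^ N * ‖(p.roots.map fun r => c - r).prod‖ := by
      gcongr
      · norm_num
      · exact (Polynomial.card_roots' p).trans hN

end BoundedDegree

section LineRestriction

variable {σ R : Type*} [CommSemiring R]

/-- The restriction `F(x + t y)` of the polynomial `F` to the line through `x` with direction `y`,
as a polynomial in `t`. -/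
noncomputable def lineRestriction (x y : σ → R) : MvPolynomial σ R →ₐ[R] Polynomial R :=
  MvPolynomial.aeval fun i => Polynomial.C (x i) + Polynomial.C (y i) * Polynomial.X

@[simp]
lemma lineRestriction_X (x y : σ → R) (i : σ) :
    lineRestriction x y (MvPolynomial.X i) =
      Polynomial.C (x i) + Polynomial.C (y i) * Polynomial.X :=
  MvPolynomial.aeval_X _ i

lemma eval_lineRestriction (x y : σ → R) (F : MvPolynomial σ R) (t : R) :
    (lineRestriction x y F).eval t = F.eval (x + t • y) := by
  have h : (Polynomial.aeval t).comp (lineRestriction x y) = MvPolynomial.aeval (x + t • y) := by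
    ext i
    simp [mul_comm t]
  simpa [Polynomial.coe_aeval_eq_eval, MvPolynomial.coe_aeval_eq_eval] using DFunLike.congr_fun h F

lemma natDegree_lineRestriction_le (x y : σ → R) (F : MvPolynomial σ R) :
    (lineRestriction x y F).natDegree ≤ F.totalDegree := by
  rw [← mul_one F.totalDegree]
  exact MvPolynomial.aeval_natDegree_le F le_rfl _ fun i => by compute_degree

lemma derivative_lineRestriction_single [DecidableEq σ] (x : σ → R) (v : σ)
    (F : MvPolynomial σ R) :
    (lineRestriction x (Pi.single v 1) F).derivative =
      lineRestriction x (Pi.single v 1) (MvPolynomial.pderiv v F) := by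
  induction F using MvPolynomial.induction_on with
  | C a => simp [← MvPolynomial.algebraMap_eq]
  | add F G hF hG => simp only [map_add, hF, hG]
  | mul_X F i hF =>
    rcases eq_or_ne i v with rfl | hi
    · simp only [map_mul, lineRestriction_X, Pi.single_eq_same, Polynomial.derivative_mul, hF,
        Derivation.leibniz, MvPolynomial.pderiv_X_self, smul_eq_mul, mul_one, map_add, map_one,
        Polynomial.derivative_C, Polynomial.derivative_X, one_mul, zero_add]
      ring
    · simp [hF, hi, mul_comm]

end LineRestriction

lemma eq_zero_or_forall_eval_ne_zero_of_tendsto {K σ ι : Type*} [NontriviallyNormedField K]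
    [IsAlgClosed K] {l : Filter ι} [l.NeBot] {P : ι → MvPolynomial σ K} {F : MvPolynomial σ K}
    {N : ℕ} {U : Set (σ → K)} (hU : IsOpen U) (hN : ∀ᶠ i in l, (P i).totalDegree ≤ N)
    (hP : ∀ᶠ i in l, P i = 0 ∨ ∀ x ∈ U, (P i).eval x ≠ 0)
    (hF : ∀ x, Tendsto (fun i => (P i).eval x) l (𝓝 (F.eval x))) :
    F = 0 ∨ ∀ x ∈ U, F.eval x ≠ 0 := by
  by_contra! ⟨hF0, x, hx, hFx⟩
  have : Infinite K := NontriviallyNormedField.infinite K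
  refine hF0 (MvPolynomial.funext fun y => ?_)
  have hline : ∀ t : K, Tendsto (fun i => (lineRestriction x (y - x) (P i)).eval t) l
      (𝓝 ((lineRestriction x (y - x) F).eval t)) := by
    simpa only [eval_lineRestriction] using fun t => hF _
  have hcont : Continuous fun t : K => x + t • (y - x) := by fun_prop
  obtain ⟨δ, hδ, hball⟩ := Metric.isOpen_iff.1 (hU.preimage hcont) 0 (by simpa using hx)
  have hzero : ∀ t ∈ Metric.ball (0 : K) δ, (lineRestriction x (y - x) F).eval t = 0 := by
    intro t ht
    have hle : ∀ᶠ i in l, ‖(lineRestriction x (y - x) (P i)).eval t‖ ≤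
        2 ^ N * ‖(lineRestriction x (y - x) (P i)).eval 0‖ := by
      filter_upwards [hN, hP] with i hNi hPi
      rcases hPi with hPi | hPi
      · simp [hPi]
      refine norm_eval_le_of_forall_ball_ne_zero (IsAlgClosed.splits _)
        ((natDegree_lineRestriction_le _ _ _).trans hNi) (fun s hs => ?_) ht
      rw [eval_lineRestriction]
      exact hPi _ (hball hs)
    have hlim := le_of_tendsto_of_tendsto (hline t).norm ((hline 0).norm.const_mul _) hle
    simpa [eval_lineRestriction x, hFx] using hlim
  have hF' : lineRestriction x (y - x) F = 0 :=
    Polynomial.eq_zero_of_infinite_isRoot _ <|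
      (infinite_of_mem_nhds 0 (Metric.ball_mem_nhds 0 hδ)).mono hzero
  simpa [hF'] using (eval_lineRestriction x (y - x) F 1).symm

section DegreeMultiplier

variable {σ R : Type*} [CommSemiring R]

/-- The linear operator multiplying every monomial `x^d` by `κ (d v)`, that is, a multiplier
sequence acting in the variable `x v` alone. Applied once for each vertex `v`, with `κ = u v`, it
turns the polynomial with all activities equal to `1` into the one with activities `u`. -/
noncomputable def degreeMultiplier (v : σ) (κ : ℕ → R) : MvPolynomial σ R →ₗ[R] MvPolynomial σ R :=
  (MvPolynomial.basisMonomials σ R).constr R fun d => MvPolynomial.monomial d (κ (d v))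

@[simp]
lemma degreeMultiplier_monomial (v : σ) (κ : ℕ → R) (d : σ →₀ ℕ) (c : R) :
    degreeMultiplier v κ (MvPolynomial.monomial d c) = MvPolynomial.monomial d (κ (d v) * c) := by
  have h := (MvPolynomial.basisMonomials σ R).constr_basis R
    (fun d => MvPolynomial.monomial d (κ (d v))) d
  rw [MvPolynomial.coe_basisMonomials] at h
  rw [← mul_one c, ← smul_eq_mul, ← MvPolynomial.smul_monomial, map_smul, degreeMultiplier, h,
    MvPolynomial.smul_monomial, smul_eq_mul, mul_comm, smul_eq_mul, mul_one]

lemma coeff_degreeMultiplier (v : σ) (κ : ℕ → R) (F : MvPolynomial σ R) (d : σ →₀ ℕ) :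
    (degreeMultiplier v κ F).coeff d = κ (d v) * F.coeff d := by
  classical
  induction F using MvPolynomial.induction_on' with
  | monomial e c =>
    rw [degreeMultiplier_monomial, MvPolynomial.coeff_monomial, MvPolynomial.coeff_monomial]
    split_ifs with h
    · rw [h]
    · rw [mul_zero]
  | add F G hF hG => simp only [map_add, MvPolynomial.coeff_add, hF, hG, mul_add]

lemma totalDegree_degreeMultiplier_le (v : σ) (κ : ℕ → R) (F : MvPolynomial σ R) :
    (degreeMultiplier v κ F).totalDegree ≤ F.totalDegree := by
  refine MvPolynomial.totalDegree_le_of_support_subset fun d hd => ?_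
  rw [MvPolynomial.mem_support_iff, coeff_degreeMultiplier] at hd
  exact MvPolynomial.mem_support_iff.2 (right_ne_zero_of_mul hd)

lemma eval_degreeMultiplier_pow [DecidableEq σ] (v : σ) (t : R) (F : MvPolynomial σ R)
    (x : σ → R) :
    (degreeMultiplier v (t ^ ·) F).eval x = F.eval (Function.update x v (t * x v)) := by
  induction F using MvPolynomial.induction_on' with
  | monomial d c =>
    have hcongr : (d.erase v).prod (fun i n => Function.update x v (t * x v) i ^ n) =
        (d.erase v).prod fun i n => x i ^ n :=
      Finsupp.prod_congr fun i hi => by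
        rw [Function.update_of_ne fun h => by simp [h] at hi]
    rw [degreeMultiplier_monomial, MvPolynomial.eval_monomial, MvPolynomial.eval_monomial,
      ← Finsupp.mul_prod_erase' d v (fun i n => x i ^ n) fun _ => pow_zero _,
      ← Finsupp.mul_prod_erase' d v (fun i n => Function.update x v (t * x v) i ^ n)
        fun _ => pow_zero _, hcongr, Function.update_self]
    ring
  | add F G hF hG => simp only [map_add, hF, hG]

lemma X_mul_degreeMultiplier_pderiv (v : σ) (κ : ℕ → R) (F : MvPolynomial σ R) :
    MvPolynomial.X v * degreeMultiplier v κ (MvPolynomial.pderiv v F) =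
      degreeMultiplier v (fun n => n * κ (n - 1)) F := by
  induction F using MvPolynomial.induction_on' with
  | monomial d c =>
    rw [MvPolynomial.pderiv_monomial, degreeMultiplier_monomial, degreeMultiplier_monomial,
      Finsupp.tsub_apply, Finsupp.single_eq_same]
    rcases Nat.eq_zero_or_pos (d v) with h | h
    · simp [h]
    · rw [MvPolynomial.X, MvPolynomial.monomial_mul,
        add_tsub_cancel_of_le (Finsupp.single_le_iff.2 h)]
      congr 1
      ring
  | add F G hF hG => simp only [map_add, mul_add, hF, hG]

lemma eval_degreeMultiplier_pow_add [DecidableEq σ] (v : σ) (a b t : R) (F : MvPolynomial σ R)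
    (x : σ → R) :
    (degreeMultiplier v (fun n => a * t ^ n + b * (n * t ^ (n - 1))) F).eval x =
      a * F.eval (Function.update x v (t * x v)) +
        b * (x v * (MvPolynomial.pderiv v F).eval (Function.update x v (t * x v))) := by
  have h : degreeMultiplier v (fun n => a * t ^ n + b * (n * t ^ (n - 1))) F =
      MvPolynomial.C a * degreeMultiplier v (t ^ ·) F + MvPolynomial.C b *
        (MvPolynomial.X v * degreeMultiplier v (t ^ ·) (MvPolynomial.pderiv v F)) := by
    ext d
    rw [X_mul_degreeMultiplier_pderiv]
    simp only [MvPolynomial.coeff_add, MvPolynomial.coeff_C_mul, coeff_degreeMultiplier]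
    ring
  simp only [h, map_add, map_mul, MvPolynomial.eval_C, MvPolynomial.eval_X,
    eval_degreeMultiplier_pow]

lemma tendsto_eval_degreeMultiplier [TopologicalSpace R] [IsTopologicalSemiring R] {ι : Type*}
    {l : Filter ι} {κ : ι → ℕ → R} {κ₀ : ℕ → R} (hκ : Tendsto κ l (𝓝 κ₀))
    (v : σ) (F : MvPolynomial σ R) (x : σ → R) :
    Tendsto (fun i => (degreeMultiplier v (κ i) F).eval x) l
      (𝓝 ((degreeMultiplier v κ₀ F).eval x)) := by
  induction F using MvPolynomial.induction_on' with
  | monomial d c =>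
    simp only [degreeMultiplier_monomial, MvPolynomial.eval_monomial]
    exact ((tendsto_pi_nhds.1 hκ _).mul_const _).mul_const _
  | add F G hF hG => simpa only [map_add] using hF.add hG

end DegreeMultiplier

lemma mem_sector_pi_div_two {z : ℂ} : z ∈ sector (Real.pi / 2) ↔ 0 < z.re := by
  simp only [sector, Set.mem_ofPred_eq, Complex.abs_arg_lt_pi_div_two_iff, and_or_left,
    and_comm (a := z ≠ 0), and_not_self, or_false, and_iff_left_iff_imp]
  rintro h rfl
  simp at h

lemma sector_pi : sector Real.pi = Complex.slitPlane := by
  ext z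
  rw [Complex.mem_slitPlane_iff_arg, sector, Set.mem_ofPred_eq, and_comm, abs_lt,
    and_iff_right (Complex.neg_pi_lt_arg z), (Complex.arg_le_pi z).lt_iff_ne]

lemma re_div_pos {a z : ℂ} (ha : 0 < a) (hz : 0 < z.re) : 0 < (a / z).re := by
  obtain ⟨ha, ha'⟩ := Complex.pos_iff.1 ha
  have hz0 : z ≠ 0 := fun h => by simp [h] at hz
  rw [Complex.div_re, ← ha', zero_mul, zero_div, add_zero]
  exact div_pos (mul_pos ha hz) (Complex.normSq_pos.2 hz0)

lemma add_mul_ne_zero {a b z : ℂ} (ha : 0 < a.re) (hb : 0 ≤ b) (hz : 0 ≤ z.re) : a + b * z ≠ 0 := by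
  obtain ⟨hb, hb'⟩ := Complex.nonneg_iff.1 hb
  have hre : 0 < (a + b * z).re := by
    rw [Complex.add_re, Complex.mul_re, ← hb', zero_mul, sub_zero]
    exact add_pos_of_pos_of_nonneg ha (mul_nonneg hb hz)
  exact fun h => hre.ne' (by rw [h, Complex.zero_re])

lemma one_add_mul_mul_ne_zero {a s t : ℂ} (ha : 0 ≤ a) (hs : 0 < s.re) (ht : 0 < t.re) :
    1 + a * (s * t) ≠ 0 := by
  have hs0 : s ≠ 0 := fun h => by simp [h] at hs
  convert mul_ne_zero hs0 (add_mul_ne_zero (re_div_pos zero_lt_one hs) ha ht.le) using 1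
  field_simp

lemma exists_sq_eq_of_mem_slitPlane {y : ℂ} (hy : y ∈ Complex.slitPlane) :
    ∃ t : ℂ, 0 < t.re ∧ t ^ 2 = y := by
  obtain ⟨t, rfl⟩ := IsAlgClosed.exists_pow_nat_eq y two_pos
  rcases lt_trichotomy t.re 0 with h | h | h
  · exact ⟨-t, by simpa using h, neg_sq t⟩
  · simp [Complex.mem_slitPlane_iff, sq, h, (mul_self_nonneg t.im).not_gt] at hy
  · exact ⟨t, h, rfl⟩

lemma re_eval_derivative_div_eval_nonneg {p : Polynomial ℂ} {t : ℂ}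
    (hp : ∀ r, p.IsRoot r → r.re < t.re) : 0 ≤ (p.derivative.eval t / p.eval t).re := by
  have ht : p.eval t ≠ 0 := fun h => (hp t h).false
  rw [(IsAlgClosed.splits p).eval_derivative_div_eval_of_ne_zero ht, ← Complex.coe_reAddGroupHom,
    map_multiset_sum, Multiset.map_map]
  refine Multiset.sum_nonneg (Multiset.forall_mem_map_iff.2 fun r hr => ?_)
  have hr' : 0 < (t - r).re := by simpa using hp r (Polynomial.isRoot_of_mem_roots hr)
  exact (re_div_pos zero_lt_one hr').le

section RightHalfPlane

variable {σ : Type*} {F : MvPolynomial σ ℂ}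

lemma IsNonvanishing.of_tendsto [Finite σ] {ι : Type*} {l : Filter ι} [l.NeBot] {A : Set ℂ}
    (hA : IsOpen A) {P : ι → MvPolynomial σ ℂ} {N : ℕ}
    (hN : ∀ᶠ i in l, (P i).totalDegree ≤ N) (hP : ∀ᶠ i in l, IsNonvanishing A (P i))
    (hF : ∀ x, Tendsto (fun i => (P i).eval x) l (𝓝 (F.eval x))) : IsNonvanishing A F := by
  simp only [IsNonvanishing, ← Set.mem_univ_pi] at hP ⊢
  exact eq_zero_or_forall_eval_ne_zero_of_tendsto
    (isOpen_set_pi Set.finite_univ fun _ _ => hA) hN hP hF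

lemma IsNonvanishing.X_mul {A : Set ℂ} (hA : 0 ∉ A) (hF : IsNonvanishing A F) (v : σ) :
    IsNonvanishing A (MvPolynomial.X v * F) := by
  refine hF.imp (fun h => by rw [h, mul_zero]) fun h x hx => ?_
  rw [map_mul, MvPolynomial.eval_X]
  exact mul_ne_zero (fun h0 => hA (h0 ▸ hx v)) (h x hx)

lemma isOpen_sector_pi_div_two : IsOpen (sector (Real.pi / 2)) := by
  convert isOpen_lt continuous_const Complex.continuous_re using 1
  exact Set.ext fun z => mem_sector_pi_div_two

lemma re_eval_pderiv_div_eval_nonneg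
    (hF : ∀ x : σ → ℂ, (∀ i, 0 < (x i).re) → F.eval x ≠ 0) {x : σ → ℂ}
    (hx : ∀ i, 0 < (x i).re) (v : σ) :
    0 ≤ ((MvPolynomial.pderiv v F).eval x / F.eval x).re := by
  classical
  have h := re_eval_derivative_div_eval_nonneg (p := lineRestriction x (Pi.single v 1) F)
    (t := 0) fun r hr => by
      by_contra! hr0
      refine hF _ (fun i => ?_) ((eval_lineRestriction _ _ _ _).symm.trans hr)
      rcases eq_or_ne i v with rfl | hi
      · simpa using add_pos_of_pos_of_nonneg (hx i) hr0
      · simpa [hi] using hx i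
  simpa [derivative_lineRestriction_single, eval_lineRestriction] using h

lemma mul_eval_add_mul_eval_pderiv_ne_zero
    (hF : ∀ x : σ → ℂ, (∀ i, 0 < (x i).re) → F.eval x ≠ 0) {x : σ → ℂ}
    (hx : ∀ i, 0 < (x i).re) (v : σ) {a b : ℂ} (ha : 0 < a.re) (hb : 0 ≤ b) :
    a * F.eval x + b * (MvPolynomial.pderiv v F).eval x ≠ 0 := by
  have hFx := hF x hx
  have hne := add_mul_ne_zero ha hb (re_eval_pderiv_div_eval_nonneg hF hx v)
  convert mul_ne_zero hne hFx using 1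
  field_simp

lemma IsNonvanishing.pderiv [Finite σ] (hF : IsNonvanishing (sector (Real.pi / 2)) F) (v : σ) :
    IsNonvanishing (sector (Real.pi / 2)) (MvPolynomial.pderiv v F) := by
  rcases hF with rfl | hF
  · exact Or.inl (map_zero _)
  simp only [mem_sector_pi_div_two] at hF
  let P (ε : ℝ) : MvPolynomial σ ℂ := (ε : ℂ) • F + MvPolynomial.pderiv v F
  have hdeg (ε : ℝ) :
      (P ε).totalDegree ≤ max F.totalDegree (MvPolynomial.pderiv v F).totalDegree :=
    (MvPolynomial.totalDegree_add _ _).trans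
      (max_le_max_right _ (MvPolynomial.totalDegree_smul_le _ _))
  refine .of_tendsto (l := 𝓝[>] 0) isOpen_sector_pi_div_two (.of_forall hdeg) ?_ fun x => ?_
  · filter_upwards [self_mem_nhdsWithin] with ε hε
    refine .inr fun x hx => ?_
    simp only [mem_sector_pi_div_two] at hx
    simpa only [P, map_add, MvPolynomial.smul_eval, one_mul] using
      mul_eval_add_mul_eval_pderiv_ne_zero hF hx v (a := ε) (by simpa using hε) zero_le_one
  · have hc : Continuous fun ε : ℝ => (P ε).eval x := by
      simp only [P, map_add, MvPolynomial.smul_eval]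
      fun_prop
    simpa [P] using (hc.tendsto 0).mono_left nhdsWithin_le_nhds

lemma isNonvanishing_degreeMultiplier_of_support_subset_zero_one [Finite σ]
    (hF : IsNonvanishing (sector (Real.pi / 2)) F) (v : σ) {κ : ℕ → ℂ} (hκ : 0 ≤ κ)
    (hsupp : Function.support κ ⊆ {0, 1}) :
    IsNonvanishing (sector (Real.pi / 2)) (degreeMultiplier v κ F) := by
  classical
  rcases hF with rfl | hF
  · exact .inl (map_zero _)
  simp only [mem_sector_pi_div_two] at hF
  -- At `x`, the multiplier `κ' ε` turns `F` into `x v * ((κ 0 + ε) / x v * F y + κ 1 * ∂F y)`,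
  -- where `y` is `x` with the coordinate `x v` scaled by `ε`.
  let κ' (ε : ℝ) (n : ℕ) : ℂ := (κ 0 + ε) * ε ^ n + κ 1 * (n * ε ^ (n - 1))
  refine .of_tendsto (l := 𝓝[>] 0) (P := fun ε => degreeMultiplier v (κ' ε) F)
    isOpen_sector_pi_div_two (.of_forall fun ε => totalDegree_degreeMultiplier_le v _ F) ?_
    (tendsto_eval_degreeMultiplier ?_ v F)
  · filter_upwards [self_mem_nhdsWithin] with ε hε
    refine .inr fun x hx => ?_
    simp only [mem_sector_pi_div_two] at hx
    have hε' : (0 : ℂ) < ε := Complex.zero_lt_real.2 hε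
    have hy (i) : 0 < (Function.update x v (ε * x v) i).re := by
      rcases eq_or_ne i v with rfl | hi
      · simpa using mul_pos hε (hx i)
      · simpa [hi] using hx i
    have hxv : x v ≠ 0 := fun h => by simpa [h] using hx v
    convert mul_ne_zero hxv <| mul_eval_add_mul_eval_pderiv_ne_zero hF hy v
      (re_div_pos (add_pos_of_nonneg_of_pos (hκ 0) hε') (hx v)) (hκ 1) using 1
    rw [eval_degreeMultiplier_pow_add]
    field_simp
  · have hc : Continuous κ' := by fun_prop
    have h0 : κ' 0 = κ := by
      funext n
      match n with
      | 0 => simp [κ']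
      | 1 => simp [κ']
      | n + 2 =>
        have : κ (n + 2) = 0 := by
          by_contra h
          simpa using hsupp h
        simp [κ', this]
    simpa [h0] using (hc.tendsto 0).mono_left nhdsWithin_le_nhds

lemma isNonvanishing_degreeMultiplier_of_support_subset [Finite σ]
    (hF : IsNonvanishing (sector (Real.pi / 2)) F) (v : σ) {κ : ℕ → ℂ} (hκ : 0 ≤ κ) {m : ℕ}
    (hsupp : Function.support κ ⊆ {m, m + 1}) :
    IsNonvanishing (sector (Real.pi / 2)) (degreeMultiplier v κ F) := by
  induction m generalizing F κ with
  | zero => exact isNonvanishing_degreeMultiplier_of_support_subset_zero_one hF v hκ hsupp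
  | succ m ih =>
    have hmul : degreeMultiplier v κ F = MvPolynomial.X v *
        degreeMultiplier v (fun n => κ (n + 1) / (n + 1)) (MvPolynomial.pderiv v F) := by
      rw [X_mul_degreeMultiplier_pderiv]
      congr 2
      funext n
      cases n with
      | zero => simpa using mt (@hsupp 0) (by simp)
      | succ n =>
        have : (n : ℂ) + 1 ≠ 0 := n.cast_add_one_ne_zero
        push_cast [add_tsub_cancel_right]
        field_simp
    rw [hmul]
    refine .X_mul (by simp [mem_sector_pi_div_two])
      (ih (hF.pderiv v) (fun n => ?_) fun n hn => ?_) v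
    · have : (0 : ℂ) ≤ n + 1 := by exact_mod_cast (n + 1).zero_le
      exact div_nonneg (hκ _) this
    · simpa using hsupp (show n + 1 ∈ _ from (div_ne_zero_iff.1 hn).1)

end RightHalfPlane

section Graph

variable {α β : Type*} (G : Graph α β)

lemma deg_eq_sum_singleton (H : Finset G.edgeSet) (v : G.vertexSet) :
    deg G H v = ∑ e ∈ H, deg G {e} v := by
  simp only [deg, sum_singleton]

open Classical in
lemma exists_deg_singleton_eq (e : G.edgeSet) :
    ∃ a b : G.vertexSet, deg G {e} = Pi.single a 1 + Pi.single b 1 := by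
  obtain ⟨a, b, hab⟩ := G.exists_isLink_of_mem_edgeSet e.2
  lift a to G.vertexSet using hab.left_mem
  lift b to G.vertexSet using hab.right_mem
  refine ⟨a, b, funext fun v => ?_⟩
  have hloop : G.IsLoopAt e v ↔ v = a ∧ v = b := by
    rw [← Graph.isLink_self_iff, hab.isLink_iff, Subtype.ext_iff, Subtype.ext_iff]
    tauto
  have hinc : G.Inc e v ↔ v = a ∨ v = b := by
    rw [Subtype.ext_iff, Subtype.ext_iff]
    refine ⟨fun h => h.eq_or_eq_of_isLink hab, ?_⟩
    rintro (h | h)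
    · exact h ▸ hab.inc_left
    · exact h ▸ hab.inc_right
  simp only [deg, sum_singleton, hloop, hinc, Pi.add_apply, Pi.single_apply]
  split_ifs <;> simp_all

variable {G} in
lemma deg_mono {H H' : Finset G.edgeSet} (h : H ⊆ H') (v : G.vertexSet) :
    deg G H v ≤ deg G H' v :=
  sum_le_sum_of_subset h

variable {G} in
lemma deg_singleton_of_isLoopAt {e : G.edgeSet} {v : G.vertexSet} (h : G.IsLoopAt e v) :
    deg G {e} v = 2 := by
  simp [deg, h]

variable {G} in
lemma one_le_deg_singleton_of_inc {e : G.edgeSet} {v : G.vertexSet} (h : G.Inc e v) :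
    1 ≤ deg G {e} v := by
  simp only [deg, sum_singleton, h, if_true]
  split_ifs <;> simp

lemma isMatching_iff_deg_le_one (M : Finset G.edgeSet) : IsMatching G M ↔ ∀ v, deg G M v ≤ 1 := by
  classical
  constructor
  · rintro ⟨hloop, hdisj⟩ v
    have hdeg : deg G M v = #{e ∈ M | G.Inc e.1 v} := by
      rw [deg, card_filter]
      exact sum_congr rfl fun e he => if_neg (hloop e he v)
    rw [hdeg, card_le_one]
    intro e he e' he'
    rw [mem_filter] at he he'
    by_contra hne
    exact hdisj e he.1 e' he'.1 hne v ⟨he.2, he'.2⟩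
  · intro hM
    refine ⟨fun e he v hv => ?_, fun e he e' he' hne v ⟨hv, hv'⟩ => ?_⟩
    · lift v to G.vertexSet using hv.vertex_mem
      have hle := (deg_mono (singleton_subset_iff.2 he) v).trans (hM v)
      rw [deg_singleton_of_isLoopAt hv] at hle
      omega
    · lift v to G.vertexSet using hv.vertex_mem
      have hle := (deg_mono (insert_subset he (singleton_subset_iff.2 he')) v).trans (hM v)
      rw [deg_eq_sum_singleton, sum_pair hne] at hle
      have := one_le_deg_singleton_of_inc hv
      have := one_le_deg_singleton_of_inc hv'
      omega

variable [Fintype G.vertexSet]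

lemma sum_deg (H : Finset G.edgeSet) : ∑ v, deg G H v = 2 * #H := by
  classical
  have h (e : G.edgeSet) : ∑ v, deg G {e} v = 2 := by
    obtain ⟨a, b, hab⟩ := exists_deg_singleton_eq G e
    simp [hab, sum_add_distrib]
  simp only [deg_eq_sum_singleton G H]
  rw [sum_comm]
  simp [h, mul_comm]

lemma degMonomial_eq_prod_singleton (H : Finset G.edgeSet) :
    degMonomial G H = ∏ e ∈ H, degMonomial G {e} := by
  simp only [degMonomial, deg_eq_sum_singleton G H, ← prod_pow_eq_pow_sum]
  exact prod_comm

lemma exists_eval_degMonomial_singleton_eq (e : G.edgeSet) :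
    ∃ a b : G.vertexSet, ∀ x, (degMonomial G {e}).eval x = x a * x b := by
  classical
  obtain ⟨a, b, hab⟩ := exists_deg_singleton_eq G e
  refine ⟨a, b, fun x => ?_⟩
  simp only [degMonomial, hab, Pi.add_apply, pow_add, prod_mul_distrib, map_mul]
  simp [Pi.single_apply]

lemma eval_zero_degMonomial {H : Finset G.edgeSet} (hH : H.Nonempty) :
    (degMonomial G H).eval 0 = 0 := by
  obtain ⟨e, he⟩ := hH
  obtain ⟨a, b, hab⟩ := exists_eval_degMonomial_singleton_eq G e
  rw [degMonomial_eq_prod_singleton, map_prod]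
  exact prod_eq_zero he ((hab 0).trans (mul_zero _))

lemma degMonomial_eq_monomial (H : Finset G.edgeSet) :
    degMonomial G H = MvPolynomial.monomial (Finsupp.equivFunOnFinite.symm (deg G H)) 1 := by
  rw [MvPolynomial.monomial_eq, Finsupp.prod_fintype _ _ fun _ => pow_zero _]
  simp [degMonomial]

variable [Fintype G.edgeSet]

lemma eval_Z (w : G.edgeSet → ℂ) (u : G.vertexSet → ℕ → ℂ) (x : G.vertexSet → ℂ) :
    (Z G w u).eval x = ∑ H : Finset G.edgeSet,
      edgeWeight G w H * activityWeight G u H * ∏ v, x v ^ deg G H v := by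
  simp [Z, degMonomial]

lemma Z_one (w : G.edgeSet → ℂ) :
    Z G w 1 = ∏ e, (1 + MvPolynomial.C (w e) * degMonomial G {e}) := by
  classical
  rw [prod_one_add, powerset_univ, Z]
  refine sum_congr rfl fun H _ => ?_
  rw [prod_mul_distrib, ← degMonomial_eq_prod_singleton]
  simp [edgeWeight, activityWeight]

lemma degreeMultiplier_Z [DecidableEq G.vertexSet] (w : G.edgeSet → ℂ)
    (u : G.vertexSet → ℕ → ℂ) (v : G.vertexSet) (κ : ℕ → ℂ) :
    degreeMultiplier v κ (Z G w u) = Z G w (Function.update u v (κ * u v)) := by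
  rw [Z, map_sum, Z]
  refine sum_congr rfl fun H _ => ?_
  have hu : activityWeight G (Function.update u v (κ * u v)) H =
      κ (deg G H v) * activityWeight G u H := by
    rw [activityWeight, activityWeight, ← mul_prod_erase univ _ (mem_univ v),
      ← mul_prod_erase univ _ (mem_univ v), Function.update_self, Pi.mul_apply, mul_assoc]
    congr 2
    exact prod_congr rfl fun i hi => by rw [Function.update_of_ne (ne_of_mem_erase hi)]
  rw [degMonomial_eq_monomial, MvPolynomial.C_mul_monomial, MvPolynomial.C_mul_monomial,
    degreeMultiplier_monomial, hu]
  simp only [Finsupp.equivFunOnFinite_symm_apply_apply]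
  congr 1
  ring

lemma isNonvanishing_Z_one {w : G.edgeSet → ℂ} (hw : 0 ≤ w) :
    IsNonvanishing (sector (Real.pi / 2)) (Z G w 1) := by
  refine .inr fun x hx => ?_
  simp only [mem_sector_pi_div_two] at hx
  rw [Z_one, map_prod]
  refine prod_ne_zero_iff.2 fun e _ => ?_
  obtain ⟨a, b, hab⟩ := exists_eval_degMonomial_singleton_eq G e
  simpa [hab] using one_add_mul_mul_ne_zero (hw e) (hx a) (hx b)

lemma isNonvanishing_Z {w : G.edgeSet → ℂ} (hw : 0 ≤ w) {u : G.vertexSet → ℕ → ℂ} (hu : 0 ≤ u)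
    (hsupp : ∀ v, ∃ m, Function.support (u v) ⊆ {m, m + 1}) :
    IsNonvanishing (sector (Real.pi / 2)) (Z G w u) := by
  classical
  suffices h : ∀ W : Finset G.vertexSet,
      IsNonvanishing (sector (Real.pi / 2)) (Z G w (W.piecewise u 1)) by
    simpa using h univ
  intro W
  induction W using Finset.induction_on with
  | empty => simpa using isNonvanishing_Z_one G hw
  | insert v W hv ih =>
    obtain ⟨m, hm⟩ := hsupp v
    have h := isNonvanishing_degreeMultiplier_of_support_subset ih v (hu v) hm
    rwa [degreeMultiplier_Z, piecewise_eq_of_notMem _ _ _ hv, Pi.one_apply, mul_one,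
      ← piecewise_insert] at h

lemma isNonvanishing_Z_degreeConstraint {w : G.edgeSet → ℂ} (hw : 0 ≤ w)
    {f g : G.vertexSet → ℕ} (hfg : ∀ v, g v ≤ f v + 1) :
    IsNonvanishing (sector (Real.pi / 2)) (Z G w (degreeConstraint f g)) := by
  refine isNonvanishing_Z G hw (fun v k => ?_) fun v => ⟨f v, fun k hk => ?_⟩
  · rw [degreeConstraint]
    split_ifs <;> simp
  · have hk : f v ≤ k ∧ k ≤ g v := by simpa [degreeConstraint] using hk
    have := hfg v
    simp only [Set.mem_insert_iff, Set.mem_singleton_iff]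
    omega

lemma eval_univariateZ (w : G.edgeSet → ℂ) (u : G.vertexSet → ℕ → ℂ) (t : ℂ) :
    (univariateZ G w u).eval (t ^ 2) = (Z G w u).eval fun _ => t := by
  rw [eval_Z, univariateZ, Polynomial.eval_finsetSum]
  refine sum_congr rfl fun H _ => ?_
  rw [prod_pow_eq_pow_sum, sum_deg, pow_mul]
  simp

variable {G} in
lemma IsNonvanishing.univariateZ {w : G.edgeSet → ℂ} {u : G.vertexSet → ℕ → ℂ}
    (h : IsNonvanishing (sector (Real.pi / 2)) (Z G w u)) :
    IsNonvanishing₁ (sector Real.pi) (univariateZ G w u) := by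
  refine h.imp (fun h => Polynomial.funext fun y => ?_) fun h y hy => ?_
  · obtain ⟨t, rfl⟩ := IsAlgClosed.exists_pow_nat_eq y two_pos
    rw [eval_univariateZ, h, map_zero, Polynomial.eval_zero]
  · rw [sector_pi] at hy
    obtain ⟨t, ht, rfl⟩ := exists_sq_eq_of_mem_slitPlane hy
    rw [eval_univariateZ]
    exact h _ fun _ => mem_sector_pi_div_two.2 ht

lemma Z_eq_matchingPolynomial (w : G.edgeSet → ℂ) :
    Z G w (degreeConstraint (fun _ => 0) fun _ => 1) = matchingPolynomial G w := by
  classical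
  rw [Z, matchingPolynomial, sum_filter]
  refine sum_congr rfl fun M _ => ?_
  have hM : activityWeight G (degreeConstraint (fun _ => 0) fun _ => 1) M =
      if IsMatching G M then 1 else 0 := by
    simp [isMatching_iff_deg_le_one, activityWeight, degreeConstraint, prod_ite_zero]
  rw [hM]
  split_ifs <;> simp

lemma matchingPolynomial_ne_zero (w : G.edgeSet → ℂ) : matchingPolynomial G w ≠ 0 := by
  classical
  have h1 : (matchingPolynomial G w).eval 0 = 1 := by
    rw [matchingPolynomial, map_sum, sum_eq_single ∅]
    · simp [edgeWeight, degMonomial, deg]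
    · intro M _ hM
      rw [map_mul, eval_zero_degMonomial G (nonempty_iff_ne_empty.2 hM), mul_zero]
    · simp [isMatching_iff_deg_le_one, deg]
  intro h
  simp [h] at h1

end Graph

end HeilmannLieb

theorem mainTheorem4 {α β : Type*} (G : Graph α β) [Fintype G.vertexSet] [Fintype G.edgeSet]
    (w : G.edgeSet → ℝ) (hw : ∀ e, 0 ≤ w e) :
    -- degree-constrained subgraphs
    (∀ f g : G.vertexSet → ℕ, (∀ v, f v ≤ g v ∧ g v ≤ f v + 1) →
      HeilmannLieb.IsNonvanishing (HeilmannLieb.sector (Real.pi / 2))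
        (HeilmannLieb.Z G (fun e => (w e : ℂ)) (HeilmannLieb.degreeConstraint f g)) ∧
      -- `univariateZ` is the specialization `Z(G,λ,u; y^{1/2} 1)`
      (∀ y t : ℂ, t ^ 2 = y →
        (HeilmannLieb.univariateZ G (fun e => (w e : ℂ))
            (HeilmannLieb.degreeConstraint f g)).eval y =
          MvPolynomial.eval (fun _ => t)
            (HeilmannLieb.Z G (fun e => (w e : ℂ)) (HeilmannLieb.degreeConstraint f g))) ∧
      HeilmannLieb.IsNonvanishing₁ (HeilmannLieb.sector Real.pi)
        (HeilmannLieb.univariateZ G (fun e => (w e : ℂ))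
          (HeilmannLieb.degreeConstraint f g)) ∧
      (HeilmannLieb.univariateZ G (fun e => (w e : ℂ))
          (HeilmannLieb.degreeConstraint f g) ≠ 0 →
        ∀ y : ℂ, (HeilmannLieb.univariateZ G (fun e => (w e : ℂ))
            (HeilmannLieb.degreeConstraint f g)).eval y = 0 → y.im = 0 ∧ y.re ≤ 0)) ∧
    -- the multivariate Heilmann-Lieb theorem is the case `f = 0`, `g = 1`
    (HeilmannLieb.Z G (fun e => (w e : ℂ))
        (HeilmannLieb.degreeConstraint (fun _ => 0) (fun _ => 1)) =
      HeilmannLieb.matchingPolynomial G (fun e => (w e : ℂ)) ∧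
    ∀ x : G.vertexSet → ℂ, (∀ v, x v ∈ HeilmannLieb.sector (Real.pi / 2)) →
      MvPolynomial.eval x (HeilmannLieb.matchingPolynomial G (fun e => (w e : ℂ))) ≠ 0) := by
  have hZ (f g : G.vertexSet → ℕ) (hfg : ∀ v, g v ≤ f v + 1) :=
    HeilmannLieb.isNonvanishing_Z_degreeConstraint G
      (fun e => Complex.zero_le_real.2 (hw e)) hfg
  refine ⟨fun f g hfg => ?_, HeilmannLieb.Z_eq_matchingPolynomial G _, ?_⟩
  · have hfg_nonvanishing := hZ f g fun v => (hfg v).2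
    have huni := hfg_nonvanishing.univariateZ
    refine ⟨hfg_nonvanishing, ?_, huni, fun h0 y hy => ?_⟩
    · rintro _ t rfl
      exact HeilmannLieb.eval_univariateZ G _ _ t
    · have hy' : y ∉ Complex.slitPlane := fun hmem =>
        huni.resolve_left h0 y (HeilmannLieb.sector_pi ▸ hmem) hy
      simpa [Complex.mem_slitPlane_iff, and_comm] using hy'
  · have hmatching := hZ (fun _ => 0) (fun _ => 1) fun _ => le_rfl
    rw [HeilmannLieb.Z_eq_matchingPolynomial] at hmatching
    exact hmatching.resolve_left (HeilmannLieb.matchingPolynomial_ne_zero G _)
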